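/- Let $N\ge 1$, let $X$ be a metrizable topological space and let $(\Phi(t))_{t\ge 0}$ be a continuous semiflow on $X$, i.e. $\Phi(0)=\mathrm{id}$, $\Phi(t_1+t_2)=\Phi(t_1)\circ\Phi(t_2)$, and $(t,u)\mapsto\Phi(t)u$ is continuous on $[0,\infty)\times X$. Suppose that $\Phi$ is an extended dissipative system on $\mathbb{R}^N$: to each $u\in X$ is associated a triple $(e_u,f_u,d_u)$ with $e_u,d_u\in C^0(\mathbb{R}^N,[0,\infty))$ and $f_u\in C^0(\mathbb{R}^N,\mathbb{R}^N)$ such that (A1) $e_u,f_u,d_u$ depend continuously on $u\in X$, uniformly on compact subsets of $\mathbb{R}^N$; (A2) there is a nondecreasing function $b:[0,\infty)\to[0,\infty)$, independent of $u$, with $|f_u|^2\le b(e_u)\,d_u$ on $\mathbb{R}^N$ for all $u\in X$; (A3) if $u\in X$ and $d_{\Phi(t)u}\equiv 0$ on $\mathbb{R}^N$ for all $t\in[0,\epsilon]$, for some $\epsilon>0$, then $u$ is an equilibrium, i.e. $\Phi(t)u=u$ for all $t\ge 0$ (this holds in particular if $d_u\equiv 0$ alone implies that $u$ is an equilibrium);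 (A4) for every $u\in X$, the functions $e(x,t)=e_{\Phi(t)u}(x)$, $f(x,t)=f_{\Phi(t)u}(x)$, $d(x,t)=d_{\Phi(t)u}(x)$ satisfy $\partial_t e=\operatorname{div}_x f-d$ in the sense of distributions on $\mathbb{R}^N\times(0,\infty)$. Let $u_0\in X$ be a point that is not an equilibrium, let $e,f,d$ be the functions of $(x,t)$ associated with its trajectory $\Phi(t)u_0$, and suppose that for some $\beta>0$ one has $|f(x,t)|^2\le\beta\,d(x,t)$ for all $x\in\mathbb{R}^N$ and $t\ge 0$. For $R>0$ and $t\ge0$ put $E(R,t)=\int_{|x|<R}e(x,t)\,dx$, and for $T>0$ let $J_T=\{R>0 : E(R,T)\ge E(R,0)\}$. Then for every $T>0$ $$\int_1^\infty \frac{\mathbf 1_{J_T}(r)}{r^{N-1}}\,dr<\infty .$$ In particular, for $N\le2$ the energy in $\{|x|<R\}$ decreases for most radii $R$, in the following sense: if $N=1$, then $J_T$ has finite Lebesgue measure; if $N=2$, then $$\int_1^\infty\frac{\operatorname{meas}(J_T\cap[1,r])}{r^2}\,dr=\int_1^\infty\frac{\mathbf 1_{J_T}(r)}{r}\,dr<\infty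 .$$ -/

import Mathlib

open scoped NNReal ENNReal ContDiff

/-- An extended dissipative system on `ℝ^N`: a continuous semiflow `Φ` on `X`, together with an
energy density `e u`, a (backward) energy flux `f u` and an energy dissipation rate `d u` attached
to each state `u`. The spaces `C(ℝ^N, ·)` carry the compact-open topology, i.e. the topology of
uniform convergence on compact sets. -/
structure ExtendedDissipativeSystem (N : ℕ) {X : Type*} [TopologicalSpace X]
    (Φ : Flow ℝ≥0 X) where
  /-- energy density -/
  e : X → C(EuclideanSpace ℝ (Fin N), ℝ)
  /-- backward energy flux -/
  f : X → C(EuclideanSpace ℝ (Fin N), EuclideanSpace ℝ (Fin N))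
  /-- energy dissipation rate -/
  d : X → C(EuclideanSpace ℝ (Fin N), ℝ)
  e_nonneg : ∀ u x, 0 ≤ e u x
  d_nonneg : ∀ u x, 0 ≤ d u x
  continuous_e : Continuous e
  continuous_f : Continuous f
  continuous_d : Continuous d
  /-- `|f|² ≤ b(e) d` for a nondecreasing `b : [0,∞) → [0,∞)` independent of `u`. -/
  flux_bound : ∃ b : ℝ → ℝ, MonotoneOn b (Set.Ici 0) ∧ (∀ s, 0 ≤ s → 0 ≤ b s) ∧
    ∀ u x, ‖f u x‖ ^ 2 ≤ b (e u x) * d u x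
  /-- If the dissipation vanishes identically along the trajectory of `u` on some time interval
  `[0, ε]`, then `u` is an equilibrium. (This is implied by the condition that `d u = 0` at the
  single state `u` forces `u` to be an equilibrium.) -/
  equilibrium_of_dissipation_eq_zero : ∀ u : X,
    (∃ ε : ℝ≥0, 0 < ε ∧ ∀ t ≤ ε, ∀ x, d (Φ t u) x = 0) → ∀ t, Φ t u = u
  /-- `∂ₜ e = div f - d` in the sense of distributions on `ℝ^N × (0,∞)` along trajectories:
  `∫∫ (e ∂ₜφ - f · ∇φ - d φ) dx dt = 0` for every test function `φ`. -/
  energy_balance : ∀ (u : X) (φ : EuclideanSpace ℝ (Fin N) × ℝ → ℝ),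
    ContDiff ℝ ∞ φ → HasCompactSupport φ → tsupport φ ⊆ Set.univ ×ˢ Set.Ioi (0 : ℝ) →
    ∫ p : EuclideanSpace ℝ (Fin N) × ℝ,
      (e (Φ p.2.toNNReal u) p.1 * fderiv ℝ φ p (0, 1)
        - fderiv ℝ φ p (f (Φ p.2.toNNReal u) p.1, 0)
        - d (Φ p.2.toNNReal u) p.1 * φ p) = 0

namespace ExtendedDissipativeSystem

variable {N : ℕ} {X : Type*} [TopologicalSpace X] {Φ : Flow ℝ≥0 X}

/-- The energy `E(R,t) = ∫_{|x| < R} e(x,t) dx` in the ball `B_R` along the trajectory of `u₀`. -/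
noncomputable def energy (S : ExtendedDissipativeSystem N Φ) (u₀ : X) (R : ℝ) (t : ℝ≥0) : ℝ :=
  ∫ x in Metric.ball (0 : EuclideanSpace ℝ (Fin N)) R, S.e (Φ t u₀) x

/-- The set `J_T` of radii `R > 0` for which `E(R,T) ≥ E(R,0)`. -/
def radiiNoDecay (S : ExtendedDissipativeSystem N Φ) (u₀ : X) (T : ℝ≥0) : Set ℝ :=
  {R : ℝ | 0 < R ∧ S.energy u₀ R 0 ≤ S.energy u₀ R T}

end ExtendedDissipativeSystem

open MeasureTheory Set Filter Topology

/-! Let D(R) be the energy dissipated in the closed ball of radius R during [0,T]. Formally, the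
balance law gives E(R,T) - E(R,0) + D(R) = flux through the sphere |x| = R over [0,T]. By
Cauchy–Schwarz and |f|² ≤ β d, this flux is at most a constant times (R^(N-1) D'(R))^(1/2). For R in
J_T the left side is at least D(R), so R^(-(N-1)) ≤ A D'(R)/D(R)²
(`exists_inv_pow_le_deriv_dissipation`). The right side is A times the derivative of -1/D, and it is
integrable beyond any radius where D > 0, because D is nondecreasing
(`Monotone.integrableOn_Ioi_deriv_div_sq`). Such a radius exists because the trajectory is not an
equilibrium (`exists_dissipation_pos`).

The balance law holds only in the sense of distributions, so the flux through a sphere is replaced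
by the flux through a shell R < |x| < R + h, seen by a smooth cutoff
(`integral_cutoff_energy_sub_le`). As h tends to 0, the increments of D and of the volume, divided
by h, become derivatives (`exists_energy_sub_add_dissipation_le`). This needs D differentiable at R
only, which holds for almost every R by monotonicity. The cutoff costs only a constant factor. -/

/-! ### Distributional derivatives in time -/

/-- A test function on `(0,∞)` of vanishing integral is the derivative of a test function. -/
theorem exists_testFunction_hasDerivAt {g : ℝ → ℝ} (hg : ContDiff ℝ ∞ g)
    (hgc : HasCompactSupport g) (hgs : tsupport g ⊆ Ioi 0) (hg0 : ∫ t, g t = 0) :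
    ∃ G : ℝ → ℝ, ContDiff ℝ ∞ G ∧ HasCompactSupport G ∧ tsupport G ⊆ Ioi 0 ∧
      ∀ t, HasDerivAt G (g t) t := by
  obtain ⟨m, M, hm, hsub⟩ : ∃ m M : ℝ, 0 < m ∧ tsupport g ⊆ Icc m M := by
    rcases (tsupport g).eq_empty_or_nonempty with h | h
    · exact ⟨1, 1, one_pos, by simp [h]⟩
    · obtain ⟨a, ha⟩ := hgc.isCompact.exists_isLeast h
      obtain ⟨b, hb⟩ := hgc.isCompact.exists_isGreatest h
      exact ⟨a, b, hgs ha.1, fun x hx => ⟨ha.2 hx, hb.2 hx⟩⟩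
  have hz : ∀ t, t ∉ Icc m M → g t = 0 := fun t ht =>
    image_eq_zero_of_notMem_tsupport fun h => ht (hsub h)
  have hder : ∀ t, HasDerivAt (fun t => ∫ s in (0 : ℝ)..t, g s) (g t) t := fun t =>
    (hg.continuous.integral_hasStrictDerivAt 0 t).hasDerivAt
  -- The primitive from 0 vanishes left of `m` because `g` does, and right of `M` because the total
  -- integral is zero.
  have hsupp : Function.support (fun t => ∫ s in (0 : ℝ)..t, g s) ⊆ Icc m M := by
    intro t ht
    by_contra hn
    apply ht
    rcases lt_or_ge t m with h | h
    · refine intervalIntegral.integral_zero_ae (Eventually.of_forall fun s hs => hz s fun h' => ?_)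
      have := (uIoc_subset_uIcc hs).2
      have := (max_lt hm h)
      exact absurd h'.1 (not_le.2 (lt_of_le_of_lt ‹s ≤ _› this))
    · have hM : M < t := by
        by_contra h'
        exact hn ⟨h, not_lt.1 h'⟩
      change ∫ s in (0 : ℝ)..t, g s = 0
      rw [intervalIntegral.integral_of_le (by linarith), ← hg0]
      refine setIntegral_eq_integral_of_forall_compl_eq_zero fun s hs => hz s fun h' => hs ?_
      exact ⟨by linarith [h'.1], by linarith [h'.2]⟩
  have hts : tsupport (fun t => ∫ s in (0 : ℝ)..t, g s) ⊆ Icc m M :=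
    closure_minimal hsupp isClosed_Icc
  refine ⟨fun t => ∫ s in (0 : ℝ)..t, g s, ?_, ?_, fun t ht => hm.trans_le (hts ht).1, hder⟩
  · rw [contDiff_infty_iff_deriv]
    refine ⟨fun t => (hder t).differentiableAt, ?_⟩
    rwa [show deriv (fun t => ∫ s in (0 : ℝ)..t, g s) = g from funext fun t => (hder t).deriv]
  · exact HasCompactSupport.of_support_subset_isCompact isCompact_Icc hsupp

/-- If the continuous function `b` is the distributional derivative on `(0,∞)` of the continuous
function `a`, then `a` is a primitive of `b` on `[0,∞)`. -/
theorem sub_eq_integral_of_weak_deriv {a b : ℝ → ℝ} (ha : Continuous a) (hb : Continuous b)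
    (h : ∀ θ : ℝ → ℝ, ContDiff ℝ ∞ θ → HasCompactSupport θ → tsupport θ ⊆ Ioi 0 →
      ∫ t, (a t * deriv θ t + b t * θ t) = 0) {T : ℝ} (hT : 0 ≤ T) :
    a T - a 0 = ∫ t in (0 : ℝ)..T, b t := by
  -- Du Bois-Reymond: `c` has zero distributional derivative on (0,∞), hence is constant there.
  set c : ℝ → ℝ := fun t => a t - ∫ s in (0 : ℝ)..t, b s with hc
  have hBd : ∀ t, HasDerivAt (fun t => ∫ s in (0 : ℝ)..t, b s) (b t) t := fun t =>
    (hb.integral_hasStrictDerivAt 0 t).hasDerivAt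
  have hBc : Continuous (fun t => ∫ s in (0 : ℝ)..t, b s) :=
    continuous_iff_continuousAt.2 fun t => (hBd t).continuousAt
  have hcc : Continuous c := ha.sub hBc
  have hcw : ∀ θ : ℝ → ℝ, ContDiff ℝ ∞ θ → HasCompactSupport θ → tsupport θ ⊆ Ioi 0 →
      ∫ t, c t * deriv θ t = 0 := by
    intro θ hθ hθc hθs
    have hθ' : Continuous (deriv θ) := (contDiff_infty_iff_deriv.1 hθ).2.continuous
    have hi1 : Integrable fun t => a t * deriv θ t :=
      (ha.mul hθ').integrable_of_hasCompactSupport hθc.deriv.mul_left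
    have hi2 : Integrable fun t => b t * θ t :=
      (hb.mul hθ.continuous).integrable_of_hasCompactSupport hθc.mul_left
    have hi3 : Integrable fun t => (∫ s in (0 : ℝ)..t, b s) * deriv θ t :=
      (hBc.mul hθ').integrable_of_hasCompactSupport hθc.deriv.mul_left
    have hi4 : Integrable fun t => (∫ s in (0 : ℝ)..t, b s) * θ t :=
      (hBc.mul hθ.continuous).integrable_of_hasCompactSupport hθc.mul_left
    have hparts := integral_mul_deriv_eq_deriv_mul_of_integrable
      (u := fun t => ∫ s in (0 : ℝ)..t, b s) (v := θ) (u' := b) (v' := deriv θ)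
      (fun t _ => hBd t) (fun t _ => (hθ.differentiable (by simp) t).hasDerivAt) hi3 hi2 hi4
    have := h θ hθ hθc hθs
    rw [integral_add hi1 hi2] at this
    simp only [hc, sub_mul]
    rw [integral_sub hi1 hi3, hparts]
    linarith
  -- A bump of mass one supported in [1,3], away from 0. Subtracting `(∫ g) ψ` from a test function
  -- `g` leaves a function of mean zero, that is, the derivative of a test function.
  let ρ : ContDiffBump (2 : ℝ) := ⟨1 / 2, 1, by norm_num, by norm_num⟩
  set ψ := ρ.normed volume with hψ
  have hψs : ContDiff ℝ ∞ ψ := ρ.contDiff_normed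
  have hψc : HasCompactSupport ψ := ρ.hasCompactSupport_normed
  have hψt : tsupport ψ ⊆ Ioi 0 := by
    rw [hψ, ρ.tsupport_normed_eq, Real.closedBall_eq_Icc]
    intro x hx
    have := hx.1
    simp only [ρ] at this
    exact lt_of_lt_of_le (by norm_num) this
  have hψi : ∫ t, ψ t = 1 := ρ.integral_normed
  have hψint : Integrable ψ := hψs.continuous.integrable_of_hasCompactSupport hψc
  set k := ∫ t, c t * ψ t with hk
  have hae : ∀ᵐ t, t ∈ Ioi (0 : ℝ) → c t - k = 0 := by
    refine isOpen_Ioi.ae_eq_zero_of_integral_contDiff_smul_eq_zero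
      ((hcc.sub continuous_const).locallyIntegrable.locallyIntegrableOn _) ?_
    intro g hg hgc hgs
    have hgint : Integrable g := hg.continuous.integrable_of_hasCompactSupport hgc
    have hts : tsupport (fun t => g t - (∫ s, g s) * ψ t) ⊆ tsupport g ∪ tsupport ψ := by
      refine closure_minimal ?_ ((isClosed_tsupport _).union (isClosed_tsupport _))
      intro t ht
      by_contra hn
      rw [mem_union, not_or] at hn
      apply ht
      simp [image_eq_zero_of_notMem_tsupport hn.1, image_eq_zero_of_notMem_tsupport hn.2]
    obtain ⟨G, hG, hGc, hGs, hGd⟩ := exists_testFunction_hasDerivAt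
      (g := fun t => g t - (∫ s, g s) * ψ t) (hg.sub (contDiff_const.mul hψs))
      ((hgc.isCompact.union hψc.isCompact).of_isClosed_subset (isClosed_tsupport _) hts)
      (hts.trans (union_subset hgs hψt))
      (by rw [integral_sub hgint (hψint.const_mul _), integral_const_mul, hψi]; ring)
    have hw := hcw G hG hGc hGs
    simp only [fun t => (hGd t).deriv] at hw
    have e1 : Integrable fun t => c t * g t :=
      (hcc.mul hg.continuous).integrable_of_hasCompactSupport hgc.mul_left
    have e2 : Integrable fun t => c t * ψ t :=
      (hcc.mul hψs.continuous).integrable_of_hasCompactSupport hψc.mul_left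
    have e3 : ∀ t, c t * (g t - (∫ s, g s) * ψ t) = c t * g t - (∫ s, g s) * (c t * ψ t) :=
      fun t => by ring
    simp only [e3] at hw
    rw [integral_sub e1 (e2.const_mul _), integral_const_mul, ← hk] at hw
    have e4 : ∀ t, g t • (c t - k) = c t * g t - k * g t := fun t => by
      rw [smul_eq_mul]; ring
    simp only [e4]
    rw [integral_sub e1 (hgint.const_mul _), integral_const_mul]
    linarith
  -- Almost everywhere becomes everywhere by continuity, which also reaches the endpoint 0.
  have hEq : EqOn c (fun _ => k) (Ici 0) := by
    have h1 : EqOn c (fun _ => k) (Ioi 0) := by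
      refine Measure.eqOn_open_of_ae_eq (μ := volume) ?_ isOpen_Ioi hcc.continuousOn
        continuousOn_const
      rw [EventuallyEq, ae_restrict_iff' measurableSet_Ioi]
      filter_upwards [hae] with t ht h0 using sub_eq_zero.1 (ht h0)
    have := h1.closure hcc continuous_const
    rwa [closure_Ioi] at this
  have h0 := hEq (mem_Ici.2 le_rfl)
  have h1 := hEq (mem_Ici.2 hT)
  simp only [hc, intervalIntegral.integral_same] at h0 h1
  linarith

/-! ### Radial cutoffs -/

/-- Smooth radial cutoffs: `1` on the ball of radius `R`, `0` outside the ball of radius `R + h`,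
with gradient bounded by `C / h`, where `C` is a universal constant. -/
theorem exists_radial_cutoff :
    ∃ C : ℝ, 0 < C ∧ ∀ (E : Type) [NormedAddCommGroup E] [InnerProductSpace ℝ E] (R h : ℝ),
      0 < R → 0 < h → ∃ χ : E → ℝ, ContDiff ℝ ∞ χ ∧ (∀ x, χ x ∈ Icc (0 : ℝ) 1) ∧
        (∀ x, ‖x‖ ≤ R → χ x = 1) ∧ (∀ x, R + h ≤ ‖x‖ → χ x = 0) ∧
        ∀ x, ‖fderiv ℝ χ x‖ ≤ C / h := by
  obtain ⟨C, hC⟩ : ∃ C : ℝ≥0, LipschitzWith C Real.smoothTransition := by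
    have hd : Continuous (deriv Real.smoothTransition) :=
      (Real.smoothTransition.contDiff (n := 1)).continuous_deriv le_rfl
    have hcs : HasCompactSupport (deriv Real.smoothTransition) := by
      refine HasCompactSupport.of_support_subset_isCompact (isCompact_Icc (a := (0 : ℝ)) (b := 1)) ?_
      intro x hx
      by_contra hn
      apply hx
      rcases lt_or_ge x 0 with h0 | h0
      · have : Real.smoothTransition =ᶠ[𝓝 x] fun _ => 0 := by
          filter_upwards [Iio_mem_nhds h0] with y hy
          exact Real.smoothTransition.zero_of_nonpos (le_of_lt hy)
        rw [this.deriv_eq]; simp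
      · have h1 : 1 < x := by
          by_contra h'
          exact hn ⟨h0, not_lt.1 h'⟩
        have : Real.smoothTransition =ᶠ[𝓝 x] fun _ => 1 := by
          filter_upwards [Ioi_mem_nhds h1] with y hy
          exact Real.smoothTransition.one_of_one_le (le_of_lt hy)
        rw [this.deriv_eq]; simp
    obtain ⟨C, hC⟩ := hd.bounded_above_of_compact_support hcs
    refine ⟨C.toNNReal, lipschitzWith_of_nnnorm_deriv_le
      ((Real.smoothTransition.contDiff (n := 1)).differentiable (by simp)) fun x => ?_⟩
    rw [← NNReal.coe_le_coe, coe_nnnorm, Real.coe_toNNReal']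
    exact (hC x).trans (le_max_left _ _)
  -- The `+ 1` only makes the constant positive. It depends on no space, since the norm is
  -- 1-Lipschitz in all of them.
  refine ⟨C + 1, by positivity, fun E _ _ R h hR hh => ?_⟩
  have hone : ∀ x : E, ‖x‖ ≤ R → Real.smoothTransition ((R + h - ‖x‖) / h) = 1 := fun x hx =>
    Real.smoothTransition.one_of_one_le (by rw [le_div_iff₀ hh]; linarith)
  refine ⟨fun x => Real.smoothTransition ((R + h - ‖x‖) / h), ?_, ?_, hone, ?_, ?_⟩
  · rw [contDiff_iff_contDiffAt]
    intro x
    rcases eq_or_ne x 0 with rfl | hx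
    -- The norm is not smooth at 0, but the cutoff is constant near 0.
    · have : (fun x : E => Real.smoothTransition ((R + h - ‖x‖) / h)) =ᶠ[𝓝 0] fun _ => 1 := by
        filter_upwards [Metric.ball_mem_nhds (0 : E) hR] with y hy
        exact hone y (by simpa using (mem_ball_zero_iff.1 hy).le)
      exact contDiffAt_const.congr_of_eventuallyEq this
    · exact (Real.smoothTransition.contDiffAt (n := ⊤)).comp x
        ((contDiffAt_const.sub (contDiffAt_norm ℝ hx)).div_const _)
  · exact fun x => ⟨Real.smoothTransition.nonneg _, Real.smoothTransition.le_one _⟩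
  · exact fun x hx => Real.smoothTransition.zero_of_nonpos
      (div_nonpos_of_nonpos_of_nonneg (by linarith) hh.le)
  · intro x
    have hlip : LipschitzWith (C / h.toNNReal)
        fun x : E => Real.smoothTransition ((R + h - ‖x‖) / h) := by
      refine LipschitzWith.of_dist_le_mul fun x y => (hC.dist_le_mul _ _).trans ?_
      rw [NNReal.coe_div, Real.coe_toNNReal _ hh.le, div_mul_eq_mul_div, mul_div_assoc]
      gcongr
      rw [Real.dist_eq, ← sub_div, abs_div, abs_of_pos hh]
      gcongr
      rw [show R + h - ‖x‖ - (R + h - ‖y‖) = ‖y‖ - ‖x‖ by ring, dist_comm, dist_eq_norm]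
      exact abs_norm_sub_norm_le y x
    refine (norm_fderiv_le_of_lipschitz ℝ hlip).trans ?_
    rw [NNReal.coe_div, Real.coe_toNNReal _ hh.le]
    gcongr
    linarith

/-! ### Localized energy balance -/

section Balance

variable {E : Type} [NormedAddCommGroup E] [InnerProductSpace ℝ E] [FiniteDimensional ℝ E]
  [MeasurableSpace E] [BorelSpace E] {e d : ℝ → E → ℝ} {f : ℝ → E → E}

theorem continuous_integral_of_forall_notMem_eq_zero {g : ℝ → E → ℝ}
    (hg : Continuous (Function.uncurry g)) {s : Set E} (hs : IsCompact s)
    (h0 : ∀ t, ∀ x ∉ s, g t x = 0) : Continuous fun t => ∫ x, g t x := by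
  have := continuous_parametric_integral_of_continuous (μ := volume) hg hs
  simpa only [fun t => setIntegral_eq_integral_of_forall_compl_eq_zero (μ := volume) (h0 t)]
    using this

/-- Localization of the balance law `∂ₜ e = div f - d` by a spatial test function `χ`, integrated
in time. -/
theorem integral_cutoff_energy_sub (he : Continuous (Function.uncurry e))
    (hd : Continuous (Function.uncurry d)) (hf : Continuous (Function.uncurry f))
    (hbal : ∀ φ : E × ℝ → ℝ, ContDiff ℝ ∞ φ → HasCompactSupport φ →
      tsupport φ ⊆ univ ×ˢ Ioi (0 : ℝ) →
      ∫ p : E × ℝ, (e p.2 p.1 * fderiv ℝ φ p (0, 1) - fderiv ℝ φ p (f p.2 p.1, 0)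
        - d p.2 p.1 * φ p) = 0)
    {χ : E → ℝ} (hχ : ContDiff ℝ ∞ χ) (hχc : HasCompactSupport χ) {T : ℝ} (hT : 0 ≤ T) :
    (∫ x, χ x * e T x) - ∫ x, χ x * e 0 x =
      ∫ t in (0 : ℝ)..T, ∫ x, (-(fderiv ℝ χ x (f t x)) - χ x * d t x) := by
  have hχ' : Continuous (fderiv ℝ χ) := hχ.continuous_fderiv (by simp)
  have hz : ∀ x ∉ tsupport χ, χ x = 0 := fun x hx => image_eq_zero_of_notMem_tsupport hx
  have hz' : ∀ x ∉ tsupport χ, fderiv ℝ χ x = 0 := fun x hx => by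
    by_contra h
    exact hx (support_fderiv_subset ℝ h)
  have cE : Continuous (Function.uncurry fun t x => χ x * e t x) :=
    (hχ.continuous.comp continuous_snd).mul he
  have cB : Continuous (Function.uncurry fun t x => -(fderiv ℝ χ x (f t x)) - χ x * d t x) :=
    (((hχ'.comp continuous_snd).clm_apply hf).neg).sub ((hχ.continuous.comp continuous_snd).mul hd)
  have zB : ∀ t, ∀ x ∉ tsupport χ, -(fderiv ℝ χ x (f t x)) - χ x * d t x = 0 := fun t x hx => by
    simp [hz x hx, hz' x hx]
  have zE : ∀ t, ∀ x ∉ tsupport χ, χ x * e t x = 0 := fun t x hx => by simp [hz x hx]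
  refine sub_eq_integral_of_weak_deriv (a := fun t => ∫ x, χ x * e t x)
    (continuous_integral_of_forall_notMem_eq_zero cE hχc.isCompact zE)
    (continuous_integral_of_forall_notMem_eq_zero cB hχc.isCompact zB) ?_ hT
  intro θ hθ hθc hθs
  have hθ' : Continuous (deriv θ) := (contDiff_infty_iff_deriv.1 hθ).2.continuous
  -- Tested against the product χ(x)θ(t), the balance law becomes, by Fubini, the weak derivative in
  -- time of ∫ χ e.
  have hφ : ContDiff ℝ ∞ fun p : E × ℝ => χ p.1 * θ p.2 :=
    (hχ.comp contDiff_fst).mul (hθ.comp contDiff_snd)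
  have hts : tsupport (fun p : E × ℝ => χ p.1 * θ p.2) ⊆ tsupport χ ×ˢ tsupport θ := by
    refine closure_minimal ?_ ((isClosed_tsupport _).prod (isClosed_tsupport _))
    intro p hp
    have := mul_ne_zero_iff.1 (Function.mem_support.1 hp)
    exact ⟨subset_tsupport _ this.1, subset_tsupport _ this.2⟩
  have hφc : HasCompactSupport fun p : E × ℝ => χ p.1 * θ p.2 :=
    (hχc.isCompact.prod hθc.isCompact).of_isClosed_subset (isClosed_tsupport _) hts
  have hfd : ∀ (p : E × ℝ) (v : E) (s : ℝ), fderiv ℝ (fun p : E × ℝ => χ p.1 * θ p.2) p (v, s)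
      = χ p.1 * (deriv θ p.2 * s) + θ p.2 * fderiv ℝ χ p.1 v := by
    intro p v s
    have h1 : HasFDerivAt (fun p : E × ℝ => χ p.1)
        ((fderiv ℝ χ p.1).comp (ContinuousLinearMap.fst ℝ E ℝ)) p :=
      ((hχ.differentiable (by simp) p.1).hasFDerivAt).comp p hasFDerivAt_fst
    have h2 : HasFDerivAt (fun p : E × ℝ => θ p.2)
        ((fderiv ℝ θ p.2).comp (ContinuousLinearMap.snd ℝ E ℝ)) p :=
      ((hθ.differentiable (by simp) p.2).hasFDerivAt).comp p hasFDerivAt_snd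
    have h3 : HasFDerivAt (fun p : E × ℝ => χ p.1 * θ p.2) _ p := h1.mul h2
    rw [h3.fderiv]
    have : fderiv ℝ θ p.2 s = deriv θ p.2 * s := by
      rw [← toSpanSingleton_deriv]; simp [mul_comm]
    simp [this]
  have key := hbal _ hφ hφc (hts.trans (prod_mono (subset_univ _) hθs))
  simp only [hfd] at key
  set F : E × ℝ → ℝ := fun p => deriv θ p.2 * (χ p.1 * e p.2 p.1)
    + θ p.2 * (-(fderiv ℝ χ p.1 (f p.2 p.1)) - χ p.1 * d p.2 p.1) with hF
  have hFc : Continuous F :=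
    ((hθ'.comp continuous_snd).mul (cE.comp continuous_swap)).add
      ((hθ.continuous.comp continuous_snd).mul (cB.comp continuous_swap))
  have hFs : HasCompactSupport F := by
    refine HasCompactSupport.of_support_subset_isCompact
      (hχc.isCompact.prod (hθc.isCompact)) fun p hp => ?_
    by_contra hn
    apply hp
    by_cases h1 : p.1 ∈ tsupport χ
    · have h2 : p.2 ∉ tsupport θ := fun h2 => hn ⟨h1, h2⟩
      have h3 : deriv θ p.2 = 0 := by
        by_contra h
        exact h2 (support_deriv_subset h)
      simp [hF, h3, image_eq_zero_of_notMem_tsupport h2]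
    · simp only [hF, zE p.2 p.1 h1, zB p.2 p.1 h1]; simp
  have hFi : Integrable F (volume.prod volume) :=
    hFc.integrable_of_hasCompactSupport hFs
  have hFeq : ∫ p, F p = 0 := by
    rw [← key]
    refine integral_congr_ae (Eventually.of_forall fun p => ?_)
    simp only [hF, map_zero]
    ring
  rw [Measure.volume_eq_prod, integral_prod_symm _ hFi] at hFeq
  rw [← hFeq]
  refine integral_congr_ae (Eventually.of_forall fun t => ?_)
  have iE : Integrable fun x => χ x * e t x :=
    (cE.comp (Continuous.prodMk_right t)).integrable_of_hasCompactSupport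
      (HasCompactSupport.of_support_subset_isCompact hχc.isCompact fun x hx => by
        by_contra h; exact hx (zE t x h))
  have iB : Integrable fun x => -(fderiv ℝ χ x (f t x)) - χ x * d t x :=
    (cB.comp (Continuous.prodMk_right t)).integrable_of_hasCompactSupport
      (HasCompactSupport.of_support_subset_isCompact hχc.isCompact fun x hx => by
        by_contra h; exact hx (zB t x h))
  simp only [hF]
  rw [integral_add (iE.const_mul _) (iB.const_mul _), integral_const_mul, integral_const_mul]
  ring

/-- Localized energy inequality: the flux through the shell `R < |x| ≤ R + h` is controlled by
the volume of the shell and the dissipation therein. -/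
theorem integral_cutoff_energy_sub_le (he : Continuous (Function.uncurry e))
    (hd : Continuous (Function.uncurry d)) (hf : Continuous (Function.uncurry f))
    (hbal : ∀ φ : E × ℝ → ℝ, ContDiff ℝ ∞ φ → HasCompactSupport φ →
      tsupport φ ⊆ univ ×ˢ Ioi (0 : ℝ) →
      ∫ p : E × ℝ, (e p.2 p.1 * fderiv ℝ φ p (0, 1) - fderiv ℝ φ p (f p.2 p.1, 0)
        - d p.2 p.1 * φ p) = 0)
    (hd0 : ∀ t x, 0 ≤ d t x) {β : ℝ} (hflux : ∀ t x, ‖f t x‖ ^ 2 ≤ β * d t x)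
    {χ : E → ℝ} (hχ : ContDiff ℝ ∞ χ) (hχ01 : ∀ x, χ x ∈ Icc (0 : ℝ) 1) {R h K : ℝ} (hh : 0 ≤ h)
    (hχ1 : ∀ x, ‖x‖ ≤ R → χ x = 1) (hχ0 : ∀ x, R + h ≤ ‖x‖ → χ x = 0)
    (hK : ∀ x, ‖fderiv ℝ χ x‖ ≤ K) {l : ℝ} (hl : 0 < l) {T : ℝ} (hT : 0 ≤ T) :
    ((∫ x, χ x * e T x) - ∫ x, χ x * e 0 x) ≤
      K * (l / 2 * (T * (volume.real (Metric.closedBall (0 : E) (R + h))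
            - volume.real (Metric.closedBall (0 : E) R)))
        + β / (2 * l) * ((∫ t in (0 : ℝ)..T, ∫ x in Metric.closedBall (0 : E) (R + h), d t x)
            - ∫ t in (0 : ℝ)..T, ∫ x in Metric.closedBall (0 : E) R, d t x))
      - ∫ t in (0 : ℝ)..T, ∫ x in Metric.closedBall (0 : E) R, d t x := by
  have hcpt : ∀ r, IsCompact (Metric.closedBall (0 : E) r) := fun r => isCompact_closedBall _ _
  have hK0 : 0 ≤ K := (norm_nonneg _).trans (hK 0)
  have hχc : HasCompactSupport χ :=
    HasCompactSupport.of_support_subset_isCompact (hcpt (R + h)) fun x hx => by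
      by_contra hn
      rw [mem_closedBall_zero_iff, not_le] at hn
      exact hx (hχ0 x hn.le)
  -- The cutoff attains its extreme values 1 and 0 at these points, so the gradient vanishes even on
  -- the two bounding spheres.
  have hz1 : ∀ x, ‖x‖ ≤ R → fderiv ℝ χ x = 0 := fun x hx =>
    IsLocalMax.fderiv_eq_zero (Eventually.of_forall fun y => by
      rw [hχ1 x hx]; exact (hχ01 y).2)
  have hz0 : ∀ x, R + h ≤ ‖x‖ → fderiv ℝ χ x = 0 := fun x hx =>
    IsLocalMin.fderiv_eq_zero (Eventually.of_forall fun y => by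
      rw [hχ0 x hx]; exact (hχ01 y).1)
  have hχ' : Continuous (fderiv ℝ χ) := hχ.continuous_fderiv (by simp)
  have hz : ∀ x ∉ tsupport χ, χ x = 0 := fun x hx => image_eq_zero_of_notMem_tsupport hx
  have hz' : ∀ x ∉ tsupport χ, fderiv ℝ χ x = 0 := fun x hx => by
    by_contra h
    exact hx (support_fderiv_subset ℝ h)
  have cB : Continuous (Function.uncurry fun t x => -(fderiv ℝ χ x (f t x)) - χ x * d t x) :=
    (((hχ'.comp continuous_snd).clm_apply hf).neg).sub ((hχ.continuous.comp continuous_snd).mul hd)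
  have zB : ∀ t, ∀ x ∉ tsupport χ, -(fderiv ℝ χ x (f t x)) - χ x * d t x = 0 := fun t x hx => by
    simp [hz x hx, hz' x hx]
  have cD : ∀ r, Continuous fun t => ∫ x in Metric.closedBall (0 : E) r, d t x := fun r =>
    continuous_parametric_integral_of_continuous hd (hcpt r)
  have cdt : ∀ t, Continuous (d t) := fun t => hd.comp (Continuous.prodMk_right t)
  have hsub : Metric.closedBall (0 : E) R ⊆ Metric.closedBall 0 (R + h) :=
    Metric.closedBall_subset_closedBall (by linarith)
  -- At fixed time, the integrand is -d in the inner ball and zero beyond the shell. In the shell it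
  -- is at most K|f|, the term -χ d being dropped by sign.
  have pt : ∀ t, (∫ x, (-(fderiv ℝ χ x (f t x)) - χ x * d t x)) ≤
      K * (l / 2 * (volume.real (Metric.closedBall (0 : E) (R + h))
            - volume.real (Metric.closedBall (0 : E) R))
        + β / (2 * l) * ((∫ x in Metric.closedBall (0 : E) (R + h), d t x)
            - ∫ x in Metric.closedBall (0 : E) R, d t x))
      - ∫ x in Metric.closedBall (0 : E) R, d t x := by
    intro t
    have id : ∀ r, IntegrableOn (d t) (Metric.closedBall (0 : E) r) := fun r =>
      (cdt t).continuousOn.integrableOn_compact (hcpt r)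
    have ic : ∀ r, IntegrableOn (fun _ => K * (l / 2)) (Metric.closedBall (0 : E) r) := fun r =>
      continuousOn_const.integrableOn_compact (hcpt r)
    have ig : ∀ r, IntegrableOn (fun x => K * (l / 2) + K * (β / (2 * l)) * d t x)
        (Metric.closedBall (0 : E) r) := fun r =>
      (ic r).add ((id r).const_mul _)
    have iB : Integrable fun x => -(fderiv ℝ χ x (f t x)) - χ x * d t x :=
      (cB.comp (Continuous.prodMk_right t)).integrable_of_hasCompactSupport
        (HasCompactSupport.of_support_subset_isCompact hχc.isCompact fun x hx => by
          by_contra h; exact hx (zB t x h))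
    have mB : ∀ r, MeasurableSet (Metric.closedBall (0 : E) r) := fun r =>
      Metric.isClosed_closedBall.measurableSet
    have ish : IntegrableOn (fun x => K * (l / 2) + K * (β / (2 * l)) * d t x)
        (Metric.closedBall (0 : E) (R + h) \ Metric.closedBall 0 R) := (ig _).mono_set sdiff_subset
    calc (∫ x, (-(fderiv ℝ χ x (f t x)) - χ x * d t x))
        ≤ ∫ x, ((Metric.closedBall (0 : E) (R + h) \ Metric.closedBall 0 R).indicator
              (fun x => K * (l / 2) + K * (β / (2 * l)) * d t x) x
            - (Metric.closedBall (0 : E) R).indicator (d t) x) := by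
          refine integral_mono iB
            (((integrable_indicator_iff ((mB _).diff (mB _))).2 ish).sub
              ((integrable_indicator_iff (mB _)).2 (id _))) fun x => ?_
          by_cases h1 : ‖x‖ ≤ R
          · have h1' : x ∈ Metric.closedBall (0 : E) R := mem_closedBall_zero_iff.2 h1
            simp [indicator, h1, hz1 x h1, hχ1 x h1]
          · have h1' : x ∉ Metric.closedBall (0 : E) R := by rwa [mem_closedBall_zero_iff]
            by_cases h2 : ‖x‖ ≤ R + h
            -- Young's inequality, with `l` left free for later optimization, plays the role of
            -- Cauchy–Schwarz.
            · have hy : ‖f t x‖ ≤ l / 2 + β / (2 * l) * d t x := by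
                have h4 : β / (2 * l) * d t x = β * d t x / (2 * l) := by ring
                have h5 : l / 2 + ‖f t x‖ ^ 2 / (2 * l) - ‖f t x‖
                    = (l - ‖f t x‖) ^ 2 / (2 * l) := by field_simp; ring
                have h6 : 0 ≤ (l - ‖f t x‖) ^ 2 / (2 * l) := by positivity
                have h7 : ‖f t x‖ ^ 2 / (2 * l) ≤ β * d t x / (2 * l) := by
                  gcongr; exact hflux t x
                linarith
              have h8 : -(fderiv ℝ χ x (f t x)) ≤ K * ‖f t x‖ :=
                (neg_le_abs _).trans (((fderiv ℝ χ x).le_opNorm _).trans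
                  (mul_le_mul_of_nonneg_right (hK x) (norm_nonneg _)))
              have h9 := mul_nonneg (hχ01 x).1 (hd0 t x)
              have h10 := mul_le_mul_of_nonneg_left hy hK0
              simp only [indicator, Set.mem_sdiff, mem_closedBall_zero_iff, h1, h2, not_false_eq_true,
                and_self, if_true, if_false]
              linarith
            · simp [indicator, h1, h2, hz0 x (not_le.1 h2).le, hχ0 x (not_le.1 h2).le]
      _ = _ := by
          have iK : ∀ r, ∫ x in Metric.closedBall (0 : E) r,
              (K * (l / 2) + K * (β / (2 * l)) * d t x)
              = K * (l / 2) * volume.real (Metric.closedBall (0 : E) r)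
                + K * (β / (2 * l)) * ∫ x in Metric.closedBall (0 : E) r, d t x := fun r => by
            rw [integral_add (ic r) ((id r).const_mul _), setIntegral_const,
              integral_const_mul, smul_eq_mul, mul_comm (volume.real _)]
          rw [integral_sub ((integrable_indicator_iff ((mB _).diff (mB _))).2 ish)
              ((integrable_indicator_iff (mB _)).2 (id _)),
            integral_indicator ((mB _).diff (mB _)), integral_indicator (mB _),
            setIntegral_sdiff (mB _) (ig _) hsub,
            iK, iK]
          ring
  rw [integral_cutoff_energy_sub he hd hf hbal hχ hχc hT]
  refine (intervalIntegral.integral_mono_on hT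
    ((continuous_integral_of_forall_notMem_eq_zero cB hχc.isCompact zB).intervalIntegrable _ _)
    (Continuous.intervalIntegrable (by
      have := cD R
      have := cD (R + h)
      fun_prop) _ _) fun t _ => pt t).trans (le_of_eq ?_)
  have iD : ∀ r, IntervalIntegrable (fun t => ∫ x in Metric.closedBall (0 : E) r, d t x)
      volume 0 T := fun r => (cD r).intervalIntegrable _ _
  rw [intervalIntegral.integral_sub ((intervalIntegrable_const.add
      (((iD _).sub (iD _)).const_mul _)).const_mul _) (iD _),
    intervalIntegral.integral_const_mul, intervalIntegral.integral_add intervalIntegrable_const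
      (((iD _).sub (iD _)).const_mul _), intervalIntegral.integral_const_mul,
    intervalIntegral.integral_const_mul, intervalIntegral.integral_sub (iD _) (iD _),
    intervalIntegral.integral_const]
  simp only [smul_eq_mul, sub_zero]

end Balance

/-! ### Passage to thin shells -/

section Radial

variable {E : Type} [NormedAddCommGroup E] [InnerProductSpace ℝ E] [FiniteDimensional ℝ E]
  [MeasurableSpace E] [BorelSpace E]

/-- Integrals against cutoffs shrinking to a closed ball converge to the integral on the ball. -/
theorem tendsto_integral_cutoff_mul {g : E → ℝ} (hg : Continuous g) {R : ℝ} {h : ℕ → ℝ}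
    (hh1 : ∀ n, h n ≤ 1) (hh0 : Tendsto h atTop (𝓝 0)) {χ : ℕ → E → ℝ}
    (hχ : ∀ n, Continuous (χ n)) (hχ01 : ∀ n x, χ n x ∈ Icc (0 : ℝ) 1)
    (hχ1 : ∀ n x, ‖x‖ ≤ R → χ n x = 1) (hχ0 : ∀ n x, R + h n ≤ ‖x‖ → χ n x = 0) :
    Tendsto (fun n => ∫ x, χ n x * g x) atTop (𝓝 (∫ x in Metric.closedBall (0 : E) R, g x)) := by
  have mB : ∀ r, MeasurableSet (Metric.closedBall (0 : E) r) := fun r =>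
    Metric.isClosed_closedBall.measurableSet
  rw [← integral_indicator (mB R)]
  refine tendsto_integral_of_dominated_convergence
    ((Metric.closedBall (0 : E) (R + 1)).indicator fun x => ‖g x‖)
    (fun n => ((hχ n).mul hg).aestronglyMeasurable)
    ((integrable_indicator_iff (mB _)).2
      (hg.norm.continuousOn.integrableOn_compact (isCompact_closedBall _ _))) ?_ ?_
  · refine fun n => Eventually.of_forall fun x => ?_
    by_cases hx : ‖x‖ ≤ R + 1
    · rw [indicator_of_mem (mem_closedBall_zero_iff.2 hx), norm_mul, Real.norm_eq_abs,
        abs_of_nonneg (hχ01 n x).1]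
      exact mul_le_of_le_one_left (norm_nonneg _) (hχ01 n x).2
    · rw [hχ0 n x (by linarith [hh1 n, not_le.1 hx]), zero_mul, norm_zero]
      exact indicator_nonneg (fun _ _ => norm_nonneg _) _
  · refine Eventually.of_forall fun x => ?_
    by_cases hx : ‖x‖ ≤ R
    · rw [indicator_of_mem (mem_closedBall_zero_iff.2 hx)]
      simp [hχ1 _ x hx]
    · rw [indicator_of_notMem (by rwa [mem_closedBall_zero_iff])]
      refine tendsto_const_nhds.congr' ?_
      filter_upwards [hh0.eventually (Iio_mem_nhds (sub_pos.2 (not_le.1 hx)))] with n hn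
      rw [hχ0 n x (by have hn : h n < ‖x‖ - R := hn; linarith), zero_mul]

/-- Radial differential inequality for the energy in a ball and the total dissipation therein. -/
theorem exists_energy_sub_add_dissipation_le :
    ∃ C : ℝ, 0 < C ∧ ∀ {E : Type} [NormedAddCommGroup E] [InnerProductSpace ℝ E]
      [FiniteDimensional ℝ E] [MeasurableSpace E] [BorelSpace E] {e d : ℝ → E → ℝ} {f : ℝ → E → E},
      Continuous (Function.uncurry e) → Continuous (Function.uncurry d) →
      Continuous (Function.uncurry f) →
      (∀ φ : E × ℝ → ℝ, ContDiff ℝ ∞ φ → HasCompactSupport φ →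
        tsupport φ ⊆ univ ×ˢ Ioi (0 : ℝ) →
        ∫ p : E × ℝ, (e p.2 p.1 * fderiv ℝ φ p (0, 1) - fderiv ℝ φ p (f p.2 p.1, 0)
          - d p.2 p.1 * φ p) = 0) →
      (∀ t x, 0 ≤ d t x) → ∀ β : ℝ, (∀ t x, ‖f t x‖ ^ 2 ≤ β * d t x) →
      ∀ R T l : ℝ, 0 < R → 0 ≤ T → 0 < l →
      DifferentiableAt ℝ (fun r => ∫ t in (0 : ℝ)..T, ∫ x in Metric.closedBall (0 : E) r, d t x) R →
      (∫ x in Metric.closedBall (0 : E) R, e T x) - (∫ x in Metric.closedBall (0 : E) R, e 0 x)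
        + (∫ t in (0 : ℝ)..T, ∫ x in Metric.closedBall (0 : E) R, d t x) ≤
      C * (l / 2 * (T * (Module.finrank ℝ E * R ^ (Module.finrank ℝ E - 1)
          * volume.real (Metric.ball (0 : E) 1)))
        + β / (2 * l) *
          deriv (fun r => ∫ t in (0 : ℝ)..T, ∫ x in Metric.closedBall (0 : E) r, d t x) R) := by
  obtain ⟨C, hC, hcut⟩ := exists_radial_cutoff
  refine ⟨C, hC, ?_⟩
  intro E _ _ _ _ _ e d f he hd hf hbal hd0 β hflux R T l hR hT hl hdiff
  set D : ℝ → ℝ := fun r => ∫ t in (0 : ℝ)..T, ∫ x in Metric.closedBall (0 : E) r, d t x with hD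
  set h : ℕ → ℝ := fun n => 1 / ((n : ℝ) + 1) with hh
  have hpos : ∀ n, 0 < h n := fun n => by simp only [hh]; positivity
  have hle : ∀ n, h n ≤ 1 := fun n => by
    simp only [hh]
    rw [div_le_one (by positivity)]
    linarith [Nat.cast_nonneg (α := ℝ) n]
  have hlim : Tendsto h atTop (𝓝 0) := tendsto_one_div_add_atTop_nhds_zero_nat
  have hlim' : Tendsto h atTop (𝓝[≠] 0) :=
    tendsto_nhdsWithin_iff.2 ⟨hlim, Eventually.of_forall fun n => (hpos n).ne'⟩
  choose χ hχ hχ01 hχ1 hχ0 hχd using fun n => hcut E R (h n) hR (hpos n)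
  have hce : ∀ t, Continuous (e t) := fun t => he.comp (Continuous.prodMk_right t)
  have t1 := fun t => tendsto_integral_cutoff_mul (hce t) hle hlim
    (fun n => (hχ n).continuous) hχ01 hχ1 hχ0
  -- The gradient bound C/h turns the shell increments of dissipation and volume into difference
  -- quotients.
  have tD : Tendsto (fun n => (h n)⁻¹ * (D (R + h n) - D R)) atTop (𝓝 (deriv D R)) := by
    have := (hasDerivAt_iff_tendsto_slope_zero.1 hdiff.hasDerivAt).comp hlim'
    simpa only [Function.comp_def, smul_eq_mul] using this
  have tV : Tendsto (fun n => (h n)⁻¹ * (volume.real (Metric.closedBall (0 : E) (R + h n))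
      - volume.real (Metric.closedBall (0 : E) R))) atTop
      (𝓝 (Module.finrank ℝ E * R ^ (Module.finrank ℝ E - 1)
          * volume.real (Metric.ball (0 : E) 1))) := by
    have hp := (hasDerivAt_pow (Module.finrank ℝ E) R).mul_const
      (volume.real (Metric.ball (0 : E) 1))
    have := (hasDerivAt_iff_tendsto_slope_zero.1 hp).comp hlim'
    refine this.congr fun n => ?_
    rw [Measure.addHaar_real_closedBall _ _ hR.le,
      Measure.addHaar_real_closedBall _ _ (by linarith [hpos n])]
    simp [smul_eq_mul]
  have main : ∀ n, ((∫ x, χ n x * e T x) - ∫ x, χ n x * e 0 x) + D R ≤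
      C * (l / 2 * (T * ((h n)⁻¹ * (volume.real (Metric.closedBall (0 : E) (R + h n))
            - volume.real (Metric.closedBall (0 : E) R))))
        + β / (2 * l) * ((h n)⁻¹ * (D (R + h n) - D R))) := by
    intro n
    have := integral_cutoff_energy_sub_le he hd hf hbal hd0 hflux (hχ n) (hχ01 n) (hpos n).le
      (hχ1 n) (hχ0 n) (hχd n) hl hT
    rw [← le_sub_iff_add_le]
    refine this.trans (le_of_eq ?_)
    simp only [hD]
    rw [div_eq_mul_inv]
    ring
  exact le_of_tendsto_of_tendsto (((t1 T).sub (t1 0)).add_const _)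
    (((((tV.const_mul T).const_mul (l / 2))).add (tD.const_mul _)).const_mul C)
    (Eventually.of_forall main)

end Radial

/-! ### Integrability on half-lines -/

/-- If `D` is nondecreasing and positive at `a`, then `D' / D²` is integrable on `(a, ∞)`. -/
theorem Monotone.integrableOn_Ioi_deriv_div_sq {D : ℝ → ℝ} (hD : Monotone D) {a : ℝ}
    (ha : 0 < D a) : IntegrableOn (fun r => deriv D r / D r ^ 2) (Ioi a) := by
  -- `D` may fail to be positive left of `a`. Truncating at `D a` makes -1/D monotone on the whole
  -- line and changes nothing on (a,∞).
  have hmax : ∀ r, 0 < max (D r) (D a) := fun r => ha.trans_le (le_max_right _ _)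
  set g : ℝ → ℝ := fun r => -(max (D r) (D a))⁻¹ with hg
  have hgm : Monotone g := fun r s hrs =>
    neg_le_neg (inv_anti₀ (hmax r) (max_le_max (hD hrs) le_rfl))
  have hgi : IntegrableOn (deriv g) (Ioi a) := by
    refine integrableOn_Ioi_of_intervalIntegral_norm_bounded (l := atTop) (b := id) (D a)⁻¹ a
      (fun b => ?_) tendsto_id ?_
    · rcases le_total a b with hab | hab
      · exact (intervalIntegrable_iff_integrableOn_Ioc_of_le hab).1
          (hgm.monotoneOn _).intervalIntegrable_deriv
      · simp [Ioc_eq_empty (not_lt.2 hab)]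
    · filter_upwards [eventually_ge_atTop a] with b hab
      have h1 : ∀ r, ‖deriv g r‖ = deriv g r := fun r => Real.norm_of_nonneg hgm.deriv_nonneg
      simp only [h1, id]
      -- The integral of the derivative of a monotone function is at most its increment, here at
      -- most 1/D(a); no absolute continuity is needed.
      have := (hgm.monotoneOn (uIcc a b)).intervalIntegral_deriv_mem_uIcc
      rw [uIcc_of_le (sub_nonneg.2 (hgm hab))] at this
      refine this.2.trans ?_
      simp only [hg, max_self]
      have := inv_pos.2 (hmax b)
      linarith
  refine hgi.congr ?_
  rw [EventuallyEq, ae_restrict_iff' measurableSet_Ioi]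
  filter_upwards [hD.ae_differentiableAt] with r hr har
  have hDr : 0 < D r := ha.trans_le (hD (le_of_lt har))
  have heq : g =ᶠ[𝓝 r] fun s => -(D s)⁻¹ := by
    filter_upwards [Ioi_mem_nhds har] with s hs
    simp only [hg]
    rw [max_eq_left (hD (le_of_lt hs))]
  rw [heq.deriv_eq, (hr.hasDerivAt.fun_inv hDr.ne').fun_neg.deriv]
  ring

theorem lintegral_Ioi_inv_sq {s : ℝ} (hs : 0 < s) :
    ∫⁻ r in Ioi s, (ENNReal.ofReal (r ^ 2))⁻¹ = ENNReal.ofReal (1 / s) := by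
  have h1 : ∫⁻ r in Ioi s, (ENNReal.ofReal (r ^ 2))⁻¹
      = ∫⁻ r in Ioi s, ENNReal.ofReal (r ^ (-2 : ℝ)) := by
    refine setLIntegral_congr_fun measurableSet_Ioi fun r hr => ?_
    have hr0 : 0 < r := hs.trans hr
    change (ENNReal.ofReal (r ^ 2))⁻¹ = ENNReal.ofReal (r ^ (-2 : ℝ))
    rw [← ENNReal.ofReal_inv_of_pos (by positivity), Real.rpow_neg hr0.le]
    norm_num
  rw [h1, ← ofReal_integral_eq_lintegral_ofReal (integrableOn_Ioi_rpow_of_lt (by norm_num) hs)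
    ((ae_restrict_iff' measurableSet_Ioi).2 (Eventually.of_forall fun r hr =>
      Real.rpow_nonneg (hs.trans hr).le _)), integral_Ioi_rpow_of_lt (by norm_num) hs]
  congr 1
  norm_num [Real.rpow_neg_one]

/-- The weighted measure of a set of radii as an integral of its distribution function. -/
theorem lintegral_volume_inter_Icc_div_sq {J : Set ℝ} (hJ : MeasurableSet J) :
    ∫⁻ r in Ioi (1 : ℝ), volume (J ∩ Icc 1 r) / ENNReal.ofReal (r ^ 2) =
      ∫⁻ r in Ioi (1 : ℝ), ENNReal.ofReal (J.indicator (fun _ => (1 : ℝ)) r / r) := by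
  -- Tonelli on the pairs (r,s) with s ∈ J and s ≤ r: integrating 1/r² over r ≥ s gives 1/s.
  set A : Set (ℝ × ℝ) := {p | p.2 ∈ J ∧ p.2 ≤ p.1} with hA
  have hAm : MeasurableSet A :=
    (measurable_snd hJ).inter (measurableSet_le measurable_snd measurable_fst)
  set F : ℝ → ℝ → ℝ≥0∞ := fun r s =>
    A.indicator (fun p => (ENNReal.ofReal (p.1 ^ 2))⁻¹) (r, s) with hF
  have hFm : Measurable (Function.uncurry F) := by
    have : Measurable (fun p : ℝ × ℝ => (ENNReal.ofReal (p.1 ^ 2))⁻¹) := by fun_prop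
    exact this.indicator hAm
  have h1 : ∀ r, volume (J ∩ Icc 1 r) / ENNReal.ofReal (r ^ 2) = ∫⁻ s in Ioi (1 : ℝ), F r s := by
    intro r
    have e1 : ∀ s, F r s = (J ∩ Iic r).indicator (fun _ => (ENNReal.ofReal (r ^ 2))⁻¹) s := by
      intro s
      by_cases hs : s ∈ J ∩ Iic r
      · rw [indicator_of_mem hs]
        exact indicator_of_mem (show (r, s) ∈ A from hs) _
      · rw [indicator_of_notMem hs]
        exact indicator_of_notMem (show (r, s) ∉ A from hs) _
    simp only [e1]
    rw [lintegral_indicator (hJ.inter measurableSet_Iic), setLIntegral_const,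
      Measure.restrict_apply (hJ.inter measurableSet_Iic), inter_assoc, Iic_inter_Ioi,
      div_eq_mul_inv, mul_comm]
    congr 1
    exact measure_congr ((ae_eq_refl J).inter Ioc_ae_eq_Icc.symm)
  have h2 : ∀ s ∈ Ioi (1 : ℝ), ∫⁻ r in Ioi (1 : ℝ), F r s =
      ENNReal.ofReal (J.indicator (fun _ => (1 : ℝ)) s / s) := by
    intro s hs
    by_cases hsJ : s ∈ J
    · have e1 : ∀ r, F r s = (Ici s).indicator (fun r => (ENNReal.ofReal (r ^ 2))⁻¹) r := by
        intro r
        by_cases hr : s ≤ r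
        · rw [indicator_of_mem (mem_Ici.2 hr)]
          exact indicator_of_mem (show (r, s) ∈ A from ⟨hsJ, hr⟩) _
        · rw [indicator_of_notMem (by simpa using hr)]
          exact indicator_of_notMem (fun h : (r, s) ∈ A => hr h.2) _
      simp only [e1]
      rw [lintegral_indicator measurableSet_Ici, Measure.restrict_restrict measurableSet_Ici,
        inter_eq_left.2 (Ici_subset_Ioi.2 hs), indicator_of_mem hsJ,
        ← lintegral_Ioi_inv_sq (one_pos.trans hs)]
      exact setLIntegral_congr Ioi_ae_eq_Ici.symm
    · have e1 : ∀ r, F r s = 0 := fun r =>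
        indicator_of_notMem (fun h : (r, s) ∈ A => hsJ h.1) _
      simp [e1, indicator_of_notMem hsJ]
  simp only [h1]
  rw [lintegral_lintegral_swap hFm.aemeasurable]
  exact setLIntegral_congr_fun measurableSet_Ioi h2

/-! ### Dissipation along a trajectory -/

namespace ExtendedDissipativeSystem

variable {N : ℕ} {X : Type*} [TopologicalSpace X] {Φ : Flow ℝ≥0 X}

/-- `Real.toNNReal` freezes the trajectory at its initial point for negative times, which gives the
continuity on the whole line that the balance lemmas assume. -/
theorem continuous_trajectory (Φ : Flow ℝ≥0 X) (u₀ : X) :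
    Continuous fun t : ℝ => Φ t.toNNReal u₀ :=
  Φ.continuous continuous_real_toNNReal continuous_const

/-- Since e ≥ 0, both energies are nondecreasing in the radius, hence Borel. -/
theorem measurableSet_radiiNoDecay (S : ExtendedDissipativeSystem N Φ) (u₀ : X) (T : ℝ≥0) :
    MeasurableSet (S.radiiNoDecay u₀ T) := by
  have hmono : ∀ t, Monotone fun R => S.energy u₀ R t := fun t R R' h =>
    setIntegral_mono_set
      (((S.e (Φ t u₀)).continuous.continuousOn.integrableOn_compact
        (isCompact_closedBall 0 R')).mono_set Metric.ball_subset_closedBall)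
      (Eventually.of_forall fun x => S.e_nonneg _ x)
      (Metric.ball_subset_ball h).eventuallyLE
  exact measurableSet_Ioi.inter (measurableSet_le (hmono 0).measurable (hmono T).measurable)

/-- The energy dissipated in the closed ball of radius `R` during the time interval `[0,T]`. -/
noncomputable def dissipation (S : ExtendedDissipativeSystem N Φ) (u₀ : X) (T R : ℝ) : ℝ :=
  ∫ t in (0 : ℝ)..T, ∫ x in Metric.closedBall (0 : EuclideanSpace ℝ (Fin N)) R,
    S.d (Φ t.toNNReal u₀) x

theorem continuous_uncurry_d (S : ExtendedDissipativeSystem N Φ) (u₀ : X) :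
    Continuous (Function.uncurry fun (t : ℝ) x => S.d (Φ t.toNNReal u₀) x) :=
  ContinuousEval.continuous_eval.comp
    (((S.continuous_d.comp (continuous_trajectory Φ u₀)).comp continuous_fst).prodMk
      continuous_snd)

theorem continuous_setIntegral_d (S : ExtendedDissipativeSystem N Φ) (u₀ : X) (R : ℝ) :
    Continuous fun t : ℝ => ∫ x in Metric.closedBall (0 : EuclideanSpace ℝ (Fin N)) R,
      S.d (Φ t.toNNReal u₀) x :=
  continuous_parametric_integral_of_continuous (S.continuous_uncurry_d u₀)
    (isCompact_closedBall _ _)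

theorem monotone_dissipation (S : ExtendedDissipativeSystem N Φ) (u₀ : X) {T : ℝ} (hT : 0 ≤ T) :
    Monotone (S.dissipation u₀ T) := fun R R' h =>
  intervalIntegral.integral_mono_on hT ((S.continuous_setIntegral_d u₀ R).intervalIntegrable _ _)
    ((S.continuous_setIntegral_d u₀ R').intervalIntegrable _ _) fun t _ =>
    setIntegral_mono_set
      ((S.d (Φ t.toNNReal u₀)).continuous.continuousOn.integrableOn_compact
        (isCompact_closedBall 0 R'))
      (Eventually.of_forall fun x => S.d_nonneg _ x)
      (Metric.closedBall_subset_closedBall h).eventuallyLE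

/-- Along a nonconstant trajectory, some energy is dissipated in any sufficiently large ball. -/
theorem exists_dissipation_pos (S : ExtendedDissipativeSystem N Φ) {u₀ : X}
    (hu₀ : ¬ ∀ t : ℝ≥0, Φ t u₀ = u₀) {T : ℝ≥0} (hT : 0 < T) :
    ∃ R, 1 ≤ R ∧ 0 < S.dissipation u₀ T R := by
  obtain ⟨t₀, ht₀, x₀, hx₀⟩ : ∃ t₀ ≤ T, ∃ x₀, S.d (Φ t₀ u₀) x₀ ≠ 0 := by
    by_contra! h
    exact hu₀ (S.equilibrium_of_dissipation_eq_zero u₀ ⟨T, hT, h⟩)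
  -- This ball contains a neighbourhood of `x₀`. By continuity in time, positivity at the single
  -- time `t₀` suffices.
  refine ⟨‖x₀‖ + 1, by linarith [norm_nonneg x₀], ?_⟩
  refine intervalIntegral.integral_pos (by exact_mod_cast hT)
    (S.continuous_setIntegral_d u₀ _).continuousOn
    (fun t _ => setIntegral_nonneg Metric.isClosed_closedBall.measurableSet
      fun x _ => S.d_nonneg _ x)
    ⟨t₀, ⟨t₀.2, by exact_mod_cast ht₀⟩, ?_⟩
  rw [Real.toNNReal_coe, setIntegral_pos_iff_support_of_nonneg_ae
    (Eventually.of_forall fun x => S.d_nonneg _ x)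
    ((S.d (Φ t₀ u₀)).continuous.continuousOn.integrableOn_compact (isCompact_closedBall _ _))]
  have hopen : IsOpen (Function.support (S.d (Φ t₀ u₀)) ∩ Metric.ball 0 (‖x₀‖ + 1)) :=
    ((S.d (Φ t₀ u₀)).continuous.isOpen_support).inter Metric.isOpen_ball
  exact (hopen.measure_pos volume ⟨x₀, hx₀, by simp⟩).trans_le
    (measure_mono (inter_subset_inter_right _ Metric.ball_subset_closedBall))

/-- Differential inequality for the dissipation at the radii where the energy does not decay. -/
theorem exists_inv_pow_le_deriv_dissipation (hN : 1 ≤ N) (S : ExtendedDissipativeSystem N Φ)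
    (u₀ : X) {β : ℝ} (hflux : ∀ (t : ℝ≥0) (x : EuclideanSpace ℝ (Fin N)),
      ‖S.f (Φ t u₀) x‖ ^ 2 ≤ β * S.d (Φ t u₀) x) {T : ℝ≥0} (hT : 0 < T) :
    ∃ A : ℝ, ∀ R ∈ S.radiiNoDecay u₀ T, 0 < S.dissipation u₀ T R →
      DifferentiableAt ℝ (S.dissipation u₀ T) R →
      1 / R ^ (N - 1) ≤ A * (deriv (S.dissipation u₀ T) R / S.dissipation u₀ T R ^ 2) := by
  have : Nonempty (Fin N) := ⟨⟨0, hN⟩⟩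
  obtain ⟨C, hC, hmain⟩ := exists_energy_sub_add_dissipation_le
  set κ := volume.real (Metric.ball (0 : EuclideanSpace ℝ (Fin N)) 1) with hκ
  have hκ0 : 0 < κ := ENNReal.toReal_pos (Metric.measure_ball_pos _ _ one_pos).ne'
    measure_ball_lt_top.ne
  -- With B = T N κ R^(N-1), the choice l = D/(C B) makes the volume term D/2, which the left side
  -- absorbs. What remains is D² ≤ C² β B D'.
  refine ⟨C ^ 2 * β * (T * (N * κ)), fun R hR hD hdiff => ?_⟩
  have hR0 : 0 < R := hR.1
  have hTr : (0 : ℝ) < T := by exact_mod_cast hT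
  have hNr : (0 : ℝ) < N := by exact_mod_cast hN
  set D := S.dissipation u₀ T R with hDdef
  set D' := deriv (S.dissipation u₀ T) R with hD'
  have hB : 0 < T * (N * R ^ (N - 1) * κ) := by positivity
  set B := T * (N * R ^ (N - 1) * κ) with hBdef
  have hc := continuous_trajectory Φ u₀
  have hineq := hmain (e := fun t x => S.e (Φ t.toNNReal u₀) x)
    (d := fun t x => S.d (Φ t.toNNReal u₀) x) (f := fun t x => S.f (Φ t.toNNReal u₀) x)
    (ContinuousEval.continuous_eval.comp
      (((S.continuous_e.comp hc).comp continuous_fst).prodMk continuous_snd))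
    (S.continuous_uncurry_d u₀)
    (ContinuousEval.continuous_eval.comp
      (((S.continuous_f.comp hc).comp continuous_fst).prodMk continuous_snd))
    (S.energy_balance u₀) (fun t x => S.d_nonneg _ x) β (fun t x => hflux _ x) R T (D / (C * B))
    hR0 hTr.le (by positivity) hdiff
  -- Open and closed balls differ by a sphere, a null set.
  have hEq : ∀ t, S.energy u₀ R t = ∫ x in Metric.closedBall 0 R, S.e (Φ t u₀) x := fun t => by
    refine setIntegral_congr_set ?_
    refine ae_eq_set.2 ⟨?_, ?_⟩
    · rw [Set.sdiff_eq_empty.2 Metric.ball_subset_closedBall, measure_empty]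
    · rw [Metric.closedBall_sdiff_ball, Measure.addHaar_sphere]
  have hJ := hR.2
  rw [hEq, hEq] at hJ
  simp only [finrank_euclideanSpace, Fintype.card_fin, Real.toNNReal_coe, Real.toNNReal_zero]
    at hineq
  rw [← hκ, ← hBdef] at hineq
  change _ + D ≤ C * (D / (C * B) / 2 * B + β / (2 * (D / (C * B))) * D') at hineq
  have h1 : C * (D / (C * B) / 2 * B + β / (2 * (D / (C * B))) * D')
      = D / 2 + C ^ 2 * β * B * D' / (2 * D) := by
    field_simp
  rw [h1] at hineq
  have h2 : D / 2 ≤ C ^ 2 * β * B * D' / (2 * D) := by linarith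
  rw [div_le_div_iff₀ two_pos (by positivity)] at h2
  rw [← mul_div_assoc, div_le_div_iff₀ (by positivity) (by positivity)]
  rw [hBdef] at h2
  nlinarith [h2]

end ExtendedDissipativeSystem

/-! ### The theorem -/

theorem proposition4p4 {N : ℕ} (hN : 1 ≤ N) {X : Type*} [TopologicalSpace X]
    [TopologicalSpace.MetrizableSpace X] (Φ : Flow ℝ≥0 X) (S : ExtendedDissipativeSystem N Φ)
    (u₀ : X) (hu₀ : ¬ ∀ t : ℝ≥0, Φ t u₀ = u₀)
    (β : ℝ) (hβ : 0 < β) (hflux : ∀ (t : ℝ≥0) (x : EuclideanSpace ℝ (Fin N)),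
      ‖S.f (Φ t u₀) x‖ ^ 2 ≤ β * S.d (Φ t u₀) x)
    (T : ℝ≥0) (hT : 0 < T) :
    MeasureTheory.IntegrableOn
      (fun r : ℝ => (S.radiiNoDecay u₀ T).indicator (fun _ => (1 : ℝ)) r / r ^ (N - 1))
      (Set.Ioi 1) ∧
    (N = 1 → MeasureTheory.volume (S.radiiNoDecay u₀ T) < ⊤) ∧
    (N = 2 →
      (∫⁻ r : ℝ in Set.Ioi 1,
          MeasureTheory.volume (S.radiiNoDecay u₀ T ∩ Set.Icc 1 r) / ENNReal.ofReal (r ^ 2)) =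
        (∫⁻ r : ℝ in Set.Ioi 1,
          ENNReal.ofReal ((S.radiiNoDecay u₀ T).indicator (fun _ => (1 : ℝ)) r / r)) ∧
      (∫⁻ r : ℝ in Set.Ioi 1,
          MeasureTheory.volume (S.radiiNoDecay u₀ T ∩ Set.Icc 1 r) / ENNReal.ofReal (r ^ 2)) < ⊤) := by
  have hJ := S.measurableSet_radiiNoDecay u₀ T
  set J := S.radiiNoDecay u₀ T with hJdef
  obtain ⟨R₀, hR₀, hpos⟩ := S.exists_dissipation_pos hu₀ hT
  obtain ⟨A, hA⟩ := S.exists_inv_pow_le_deriv_dissipation hN u₀ hflux hT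
  have hmono := S.monotone_dissipation u₀ T.2
  have hmeas : Measurable fun r : ℝ => J.indicator (fun _ => (1 : ℝ)) r / r ^ (N - 1) :=
    (measurable_const.indicator hJ).div (by fun_prop)
  have hnn : ∀ r : ℝ, 0 ≤ r → 0 ≤ J.indicator (fun _ => (1 : ℝ)) r / r ^ (N - 1) := fun r hr =>
    div_nonneg (indicator_nonneg (fun _ _ => zero_le_one) _) (by positivity)
  have hint : IntegrableOn (fun r : ℝ => J.indicator (fun _ => (1 : ℝ)) r / r ^ (N - 1))
      (Ioi 1) := by
    -- Up to `R₀` the integrand is at most 1; beyond it, D > 0 and the differential inequality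
    -- dominates it by |A D'/D²|.
    rw [← Ioc_union_Ioi_eq_Ioi hR₀]
    refine IntegrableOn.union ?_ ?_
    · refine Measure.integrableOn_of_bounded (M := 1) measure_Ioc_lt_top.ne
        hmeas.aestronglyMeasurable ?_
      rw [ae_restrict_iff' measurableSet_Ioc]
      refine Eventually.of_forall fun r hr => ?_
      have hr1 : 1 ≤ r := hr.1.le
      rw [Real.norm_of_nonneg (hnn r (by linarith)), div_le_one (by positivity)]
      exact (indicator_le_self' (fun _ _ => zero_le_one) r).trans (one_le_pow₀ hr1)
    · refine ((hmono.integrableOn_Ioi_deriv_div_sq hpos).const_mul A).norm.mono'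
        hmeas.aestronglyMeasurable ?_
      rw [ae_restrict_iff' measurableSet_Ioi]
      filter_upwards [hmono.ae_differentiableAt] with r hr hrR
      have hr0 : 0 ≤ r := by linarith [mem_Ioi.1 hrR]
      rw [Real.norm_of_nonneg (hnn r hr0)]
      by_cases hrJ : r ∈ J
      · rw [indicator_of_mem hrJ]
        exact (hA r hrJ (hpos.trans_le (hmono (le_of_lt hrR))) hr).trans (le_abs_self _)
      · rw [indicator_of_notMem hrJ, zero_div]
        exact norm_nonneg _
  refine ⟨hint, ?_, ?_⟩
  · rintro rfl
    have hfin : volume (J ∩ Ioi 1) < ⊤ := by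
      have h1 : Integrable (J.indicator fun _ => (1 : ℝ)) (volume.restrict (Ioi 1)) := by
        simpa [IntegrableOn] using hint
      have h2 := (integrable_indicator_iff hJ).1 h1
      rw [IntegrableOn, integrable_const_iff] at h2
      have h3 := (h2.resolve_left one_ne_zero).measure_univ_lt_top
      rwa [Measure.restrict_apply_univ, Measure.restrict_apply hJ] at h3
    -- For N = 1 the weight is 1, so integrability bounds the measure of J beyond 1; radii up to 1
    -- add a bounded set.
    refine (measure_mono (t := Ioc 0 1 ∪ J ∩ Ioi 1) fun r hr => ?_).trans_lt
      ((measure_union_le _ _).trans_lt (ENNReal.add_lt_top.2 ⟨measure_Ioc_lt_top, hfin⟩))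
    rcases le_or_gt r 1 with h | h
    · exact Or.inl ⟨hr.1, h⟩
    · exact Or.inr ⟨hr, h⟩
  · rintro rfl
    have heq := lintegral_volume_inter_Icc_div_sq hJ
    refine ⟨heq, ?_⟩
    rw [heq]
    simpa using hint.lintegral_lt_top
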